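/- Let $n\ge 2$. Write $e_{ij}$ ($0\le i,j\le n$) for the matrix units of $\mathfrak{gl}_{n+1}(\mathbb C)$, and let $\mathfrak p_n\subset\mathfrak{sl}_{n+1}$ be the subalgebra of trace-zero matrices whose $(0,j)$ entries vanish for $1\le j\le n$. Let $I_{\mathbf 1}$ be the left ideal of $U(\mathfrak{sl}_{n+1})$ generated by $e_{01}-1,\dots,e_{0n}-1$, and let $$W=\{y\in U(\mathfrak p_n)\mid [e_{0i},y]\in I_{\mathbf 1}\text{ for all }1\le i\le n\}$$ be the finite $W$-algebra of $\mathfrak{sl}_{n+1}$ for the minimal nilpotent element $e_{10}+\dots+e_{n0}$. Let $\tau:W\to U(\mathfrak{gl}_n)$ be the restriction to $W$ of the homomorphism $U(\mathfrak p_n)\to U(\mathfrak{gl}_n)$ induced by the projection $\mathfrak p_n\to\mathfrak{gl}_n$ with $e_{i0}\mapsto 0$, $e_{ij}\mapsto e_{ij}$ for $i\ne j$, and $e_{ii}-\frac1{n+1}\sum_{k=0}^n e_{kk}\mapsto e_{ii}$ ($1\le i,j\le n$). Let $\sigma=\exp(-\mathrm{ad}\,X)$ be the automorphism of $U(\mathfrak{gl}_n)$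 with $X=\sum_{k=1}^{n-1}e_{kn}$, and let $\sigma\tau(W)\subset U(\mathfrak{gl}_n)$ be the image of $\sigma\circ\tau$. It contains $e_{ij}$ and $e_{nj}$ for $1\le i,j\le n-1$, and $$y_k=e_{kn}\Big(\sum_{i=1}^n e_{ii}-n\Big)+\sum_{j=1}^{n-1}e_{kj}e_{jn}\qquad(1\le k\le n).$$ Let $\sigma\tau(W)^+$ be the non-unital subalgebra generated by $y_1,\dots,y_{n-1}$ and $e_{ij}$, $1\le i<j\le n-1$. For $\lambda_1,\dots,\lambda_{n-1},\eta_n\in\mathbb C$ let $M(\lambda_1,\dots,\lambda_{n-1},\eta_n)$ be the quotient of $\sigma\tau(W)$ by the left ideal generated by $\sigma\tau(W)^+$, $y_n-\eta_n$ and $e_{ii}-\lambda_i$ ($1\le i\le n-1$), and let $L(\lambda_1,\dots,\lambda_{n-1},\eta_n)$ be its irreducible quotient, that is, its quotient by a maximal proper submodule. If the $\sigma\tau(W)$-module $L(\lambda_1,\dots,\lambda_{n-1},\eta_n)$ is finite-dimensional over $\mathbb C$, then $\lambda_i-\lambda_{i+1}\in\mathbb Z_{\ge0}$ for all $1\le i\le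 n-2$, and there is an integer $k\ge1$ such that $$\eta_n=(\lambda_{n-1}+1-k)(\lambda_1+\dots+\lambda_{n-1}-n+\lambda_{n-1}+1-k).$$ -/

import Mathlib

/-!
Throughout, `m = n - 1`, so that `gl_n` consists of the matrices indexed by `Fin (m + 1)` and
`sl_{n+1}` of the trace-zero matrices indexed by `Fin (m + 2)`, over `ℂ`.
In `sl_{n+1}` the index `0` is `0` and the indices `1, …, n` are `i.succ`, `i : Fin (m + 1)`.
In `gl_n` the indices `1, …, n-1` are `i.castSucc`, `i : Fin m`, and the index `n` is
`Fin.last m`.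
-/

noncomputable section

namespace FiniteW

attribute [local instance 100] LieRing.ofAssociativeRing

variable (m : ℕ)

/-- `gl_n`, with `n = m + 1`. -/
abbrev gl : Type := Matrix (Fin (m + 1)) (Fin (m + 1)) ℂ

/-- `sl_{n+1}`, with `n = m + 1`. -/
abbrev sl : LieSubalgebra ℂ (Matrix (Fin (m + 2)) (Fin (m + 2)) ℂ) :=
  LieAlgebra.SpecialLinear.sl (Fin (m + 2)) ℂ

/-- The matrix unit `e_{0i}` of `sl_{n+1}`, `1 ≤ i ≤ n`; these span `g(-2)`. -/
def e0 (i : Fin (m + 1)) : sl m :=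
  LieAlgebra.SpecialLinear.single 0 i.succ (Fin.succ_ne_zero i).symm 1

/-- The maximal parabolic subalgebra `p_n = g(2) ⊕ g(0)` of `sl_{n+1}`: the trace-zero matrices
whose entries at `(0, j)`, `1 ≤ j ≤ n`, vanish. -/
def parabolic : LieSubalgebra ℂ (sl m) where
  carrier := {x | ∀ j : Fin (m + 1), (x : Matrix (Fin (m + 2)) (Fin (m + 2)) ℂ) 0 j.succ = 0}
  add_mem' := by
    intro a b ha hb j
    simp [ha j, hb j]
  zero_mem' := by
    intro j
    simp
  smul_mem' := by
    intro c x hx j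
    simp [hx j]
  lie_mem' := by
    intro a b ha hb j
    rw [LieAlgebra.SpecialLinear.sl_bracket]
    simp [Matrix.mul_apply, Fin.sum_univ_succ, ha j, hb j, ha _, hb _]

/-- The canonical projection `p_n → p_n / g(2) ≅ gl_n`, under which `e_{ij}` (`i ≠ j`) goes to
`e_{ij}` and `h_i = e_{ii} - I_{n+1}/(n+1)` goes to `e_{ii}`, for `1 ≤ i, j ≤ n`. -/
def leviProj : parabolic m →ₗ⁅ℂ⁆ gl m where
  toFun x := Matrix.of fun i j =>
    (x : sl m).1 i.succ j.succ - if i = j then (x : sl m).1 0 0 else 0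
  map_add' := by
    intro x y
    ext i j
    by_cases h : i = j
    · simp [h]
      ring
    · simp [h]
  map_smul' := by
    intro c x
    ext i j
    by_cases h : i = j
    · simp [h]
      ring
    · simp [h]
  map_lie' := by
    intro x y
    have hx : ∀ j : Fin (m + 1), (x : sl m).1 0 j.succ = 0 := x.2
    have hy : ∀ j : Fin (m + 1), (y : sl m).1 0 j.succ = 0 := y.2
    ext i j
    rw [LieSubalgebra.coe_bracket, LieAlgebra.SpecialLinear.sl_bracket, Ring.lie_def]
    simp [Matrix.mul_apply, Fin.sum_univ_succ, hx, hy, sub_mul, mul_sub, Finset.sum_sub_distrib]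
    by_cases h : i = j
    · simp [h]
      ring
    · simp [h]
      ring

/-- The map `U(p_n) → U(sl_{n+1})` induced by the inclusion. -/
def inclU : UniversalEnvelopingAlgebra ℂ (parabolic m) →ₐ[ℂ] UniversalEnvelopingAlgebra ℂ (sl m) :=
  UniversalEnvelopingAlgebra.lift ℂ
    ((UniversalEnvelopingAlgebra.ι ℂ).comp (parabolic m).incl)

/-- The left ideal `I_1` of `U(sl_{n+1})` generated by `e_{01} - 1, …, e_{0n} - 1`. -/
def whittakerIdeal :
    Submodule (UniversalEnvelopingAlgebra ℂ (sl m)) (UniversalEnvelopingAlgebra ℂ (sl m)) :=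
  Submodule.span _ (Set.range fun i : Fin (m + 1) =>
    UniversalEnvelopingAlgebra.ι ℂ (e0 m i) - 1)

lemma whittakerIdeal_mul_mem {u y : UniversalEnvelopingAlgebra ℂ (sl m)}
    (hu : u ∈ whittakerIdeal m)
    (hy : ∀ i, UniversalEnvelopingAlgebra.ι ℂ (e0 m i) * y -
      y * UniversalEnvelopingAlgebra.ι ℂ (e0 m i) ∈ whittakerIdeal m) :
    u * y ∈ whittakerIdeal m := by
  induction hu using Submodule.span_induction with
  | mem x hx =>
    obtain ⟨i, rfl⟩ := hx
    have h1 : y * (UniversalEnvelopingAlgebra.ι ℂ (e0 m i) - 1) ∈ whittakerIdeal m :=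
      (whittakerIdeal m).smul_mem y (Submodule.subset_span ⟨i, rfl⟩)
    have h2 := add_mem (hy i) h1
    convert h2 using 1
    simp only [sub_mul, mul_sub, one_mul, mul_one]
    abel
  | zero => simp
  | add x z _ _ hx hz => rw [add_mul]; exact add_mem hx hz
  | smul a x _ hx => rw [smul_eq_mul, mul_assoc]; exact (whittakerIdeal m).smul_mem a hx

/-- The finite `W`-algebra `W(e)` of `sl_{n+1}` for the minimal nilpotent element
`e = e_{10} + ⋯ + e_{n0}`, as the algebra `U(p_n)^{g(-2)}` of all `y ∈ U(p_n)` such that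
`[e_{0i}, y] ∈ I_1` for all `i`. -/
def WAlg : Subalgebra ℂ (UniversalEnvelopingAlgebra ℂ (parabolic m)) where
  carrier := {y | ∀ i, UniversalEnvelopingAlgebra.ι ℂ (e0 m i) * inclU m y -
      inclU m y * UniversalEnvelopingAlgebra.ι ℂ (e0 m i) ∈ whittakerIdeal m}
  mul_mem' := by
    intro a b ha hb i
    have h1 := whittakerIdeal_mul_mem m (ha i) hb
    have h2 := add_mem h1 ((whittakerIdeal m).smul_mem (inclU m a) (hb i))
    convert h2 using 1
    simp only [map_mul, smul_eq_mul, sub_mul, mul_sub, mul_assoc]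
    abel
  add_mem' := by
    intro a b ha hb i
    convert add_mem (ha i) (hb i) using 1
    simp only [map_add, add_mul, mul_add]
    abel
  algebraMap_mem' := by
    intro r i
    simp [Algebra.commutes]

/-- The homomorphism `τ : W(e) → U(gl_n)`, the restriction to `W(e)` of the map
`U(p_n) → U(gl_n)` induced by the projection `p_n → gl_n`. -/
def tau : WAlg m →ₐ[ℂ] UniversalEnvelopingAlgebra ℂ (gl m) :=
  (UniversalEnvelopingAlgebra.lift ℂ
    ((UniversalEnvelopingAlgebra.ι ℂ).comp (leviProj m))).comp (WAlg m).val

/-- The matrix `X = ∑_{k=1}^{n-1} e_{kn}`. -/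
def X : gl m := ∑ k : Fin m, Matrix.single k.castSucc (Fin.last m) 1

lemma X_mul_X : X m * X m = 0 := by
  simp only [X, Finset.sum_mul, Finset.mul_sum]
  refine Finset.sum_eq_zero fun i _ => Finset.sum_eq_zero fun j _ => ?_
  rw [Matrix.single_mul_single_of_ne]
  exact (Fin.castSucc_lt_last _).ne'

/-- The inner derivation `-ad X` of `gl_n`, i.e. `A ↦ [A, X]`. -/
def negAdX : LieDerivation ℂ (gl m) (gl m) := LieDerivation.inner ℂ (gl m) (gl m) (X m)

lemma negAdX_apply (A : gl m) : negAdX m A = A * X m - X m * A := rfl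

lemma negAdX_pow : (negAdX m).toLinearMap ^ 3 = 0 := by
  ext1 A
  have h (B : gl m) : (negAdX m).toLinearMap B = B * X m - X m * B := rfl
  simp only [pow_succ, pow_zero, one_mul, Module.End.mul_apply, h, LinearMap.zero_apply]
  simp only [sub_mul, mul_sub, mul_assoc, X_mul_X, mul_zero]
  simp only [← mul_assoc, X_mul_X, zero_mul, mul_zero]
  simp

lemma isNilpotent_negAdX : IsNilpotent (negAdX m).toLinearMap := ⟨3, negAdX_pow m⟩

/-- The automorphism `exp(-ad X)` of the Lie algebra `gl_n`. -/
def sigmaLie : gl m ≃ₗ⁅ℂ⁆ gl m := (negAdX m).exp (isNilpotent_negAdX m)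

lemma sigmaLie_apply (A : gl m) :
    sigmaLie m A = A + (A * X m - X m * A) - X m * A * X m := by
  have h (B : gl m) : (negAdX m).toLinearMap B = B * X m - X m * B := rfl
  rw [sigmaLie, LieDerivation.exp_map_apply, IsNilpotent.exp_eq_sum (negAdX_pow m)]
  simp [Finset.sum_range_succ, pow_succ, h]
  simp only [sub_mul, mul_sub, mul_assoc, X_mul_X, mul_zero]
  simp only [← mul_assoc, X_mul_X, zero_mul]
  module

/-- The automorphism `σ` of `U(gl_n)` defined by the inner derivation `-ad X`, i.e. the
extension of `exp(-ad X)` to the enveloping algebra. -/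
def sigma : UniversalEnvelopingAlgebra ℂ (gl m) →ₐ[ℂ] UniversalEnvelopingAlgebra ℂ (gl m) :=
  UniversalEnvelopingAlgebra.lift ℂ
    ((UniversalEnvelopingAlgebra.ι ℂ).comp (sigmaLie m).toLieHom)

/-- The subalgebra `στ(W)` of `U(gl_n)`. -/
def sigmaTauW : Subalgebra ℂ (UniversalEnvelopingAlgebra ℂ (gl m)) :=
  ((sigma m).comp (tau m)).range

/-- The matrix unit `e_{ij}` of `gl_n` as an element of `U(gl_n)`. -/
def E (i j : Fin (m + 1)) : UniversalEnvelopingAlgebra ℂ (gl m) :=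
  UniversalEnvelopingAlgebra.ι ℂ (Matrix.single i j (1 : ℂ))

/-- The element `y_k = e_{kn} (I_n - n) + ∑_{j=1}^{n-1} e_{kj} e_{jn}` of `U(gl_n)`. -/
def y (k : Fin (m + 1)) : UniversalEnvelopingAlgebra ℂ (gl m) :=
  E m k (Fin.last m) * (∑ i, E m i i - ((m + 1 : ℕ) : UniversalEnvelopingAlgebra ℂ (gl m))) +
    ∑ j : Fin m, E m k j.castSucc * E m j.castSucc (Fin.last m)


/-- A section of `leviProj`. -/
def levi (A : gl m) : parabolic m :=
  ⟨⟨Matrix.of fun i j => Fin.cases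
      (Fin.cases (-(A.trace / (m + 2))) (fun _ => 0) j)
      (fun i' => Fin.cases 0 (fun j' => A i' j' - if i' = j' then A.trace / (m + 2) else 0) j) i, by
    have h1 : ((m : ℂ) + 2) ≠ 0 := by exact_mod_cast (by omega : m + 2 ≠ 0)
    refine LinearMap.mem_ker.2 ?_
    rw [Matrix.traceLinearMap_apply, Matrix.trace, Fin.sum_univ_succ]
    simp only [Matrix.diag, Matrix.of_apply, Fin.cases_zero, Fin.cases_succ, if_true,
      Finset.sum_sub_distrib, Finset.sum_const, Finset.card_univ, Fintype.card_fin]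
    have h2 : ∑ i, A i i = A.trace := rfl
    rw [h2, nsmul_eq_mul]
    push_cast
    field_simp
    ring⟩, by
    intro j
    simp⟩

lemma leviProj_levi (A : gl m) : leviProj m (levi m A) = A := by
  ext i j
  by_cases h : i = j <;> simp [leviProj, levi, h]

/-- The matrix unit `e_{i0}` as an element of `p_n`. -/
def f0 (i : Fin (m + 1)) : parabolic m :=
  ⟨LieAlgebra.SpecialLinear.single i.succ 0 (Fin.succ_ne_zero i) 1, by
    intro j
    simp [(Fin.succ_ne_zero i)]⟩

lemma leviProj_f0 (i : Fin (m + 1)) : leviProj m (f0 m i) = 0 := by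
  ext a b
  simp [leviProj, f0, Fin.succ_ne_zero, (Fin.succ_ne_zero _).symm]

lemma e0_lie_levi (k : Fin (m + 1)) (A : gl m) :
    ⁅e0 m k, (levi m A : sl m)⁆ = ∑ j, A k j • e0 m j := by
  apply Subtype.ext
  ext a b
  rw [LieAlgebra.SpecialLinear.sl_bracket]
  refine Fin.cases ?_ (fun a => ?_) a <;> refine Fin.cases ?_ (fun b => ?_) b
  · simp [e0, levi, Matrix.mul_apply, Matrix.single_apply, Matrix.sum_apply]
  · simp [e0, levi, Matrix.mul_apply, Matrix.single_apply, Matrix.sum_apply, ite_and]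
    by_cases h : k = b <;> simp [h]
  · simp [e0, levi, Matrix.mul_apply, Matrix.sum_apply, (Fin.succ_ne_zero _).symm]
  · simp [e0, levi, Matrix.mul_apply, Matrix.single_apply, Matrix.sum_apply,
      (Fin.succ_ne_zero _).symm, ite_and]

lemma e0_lie_f0 (k i : Fin (m + 1)) :
    ⁅e0 m k, (f0 m i : sl m)⁆ = -(levi m (Matrix.single i k 1) : sl m)
      - if i = k then (levi m 1 : sl m) else 0 := by
  have h1 : ((m : ℂ) + 2) ≠ 0 := by exact_mod_cast (by omega : m + 2 ≠ 0)
  apply Subtype.ext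
  ext a b
  rw [LieAlgebra.SpecialLinear.sl_bracket]
  refine Fin.cases ?_ (fun a => ?_) a <;> refine Fin.cases ?_ (fun b => ?_) b <;>
  by_cases h : i = k
  · simp [e0, f0, levi, h]
    field_simp
    ring
  · simp [e0, f0, levi, h, Ne.symm h]
  · simp [e0, f0, levi, h, (Fin.succ_ne_zero _).symm]
  · simp [e0, f0, levi, Matrix.mul_apply, h, (Fin.succ_ne_zero _).symm]
  · simp [e0, f0, levi, h, (Fin.succ_ne_zero _).symm]
  · simp [e0, f0, levi, Matrix.mul_apply, h, (Fin.succ_ne_zero _).symm]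
  · by_cases h3 : a = b
    · subst h3
      simp [e0, f0, levi, Matrix.single_apply, h, (Fin.succ_ne_zero _).symm]
      field_simp
      ring
    · simp [e0, f0, levi, Matrix.single_apply, h, h3, (Fin.succ_ne_zero _).symm]
  · simp [e0, f0, levi, Matrix.single_apply, h]

lemma e0_sub_one_mem (i : Fin (m + 1)) :
    UniversalEnvelopingAlgebra.ι ℂ (e0 m i) - 1 ∈ whittakerIdeal m :=
  Submodule.subset_span ⟨i, rfl⟩

lemma mul_e0_sub_mem (u : UniversalEnvelopingAlgebra ℂ (sl m)) (i : Fin (m + 1)) :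
    u * (UniversalEnvelopingAlgebra.ι ℂ (e0 m i) - 1) ∈ whittakerIdeal m :=
  (whittakerIdeal m).smul_mem u (e0_sub_one_mem m i)

lemma inclU_ι (x : parabolic m) :
    inclU m (UniversalEnvelopingAlgebra.ι ℂ x) = UniversalEnvelopingAlgebra.ι ℂ (x : sl m) := by
  rw [inclU, UniversalEnvelopingAlgebra.lift_ι_apply]
  rfl

/-- A matrix in `gl_n` whose row sums vanish gives an element of `W(e)`. -/
lemma levi_mem (A : gl m) (hA : ∀ i, ∑ j, A i j = 0) :
    UniversalEnvelopingAlgebra.ι ℂ (levi m A) ∈ WAlg m := by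
  intro k
  rw [inclU_ι, ← Ring.lie_def, ← LieHom.map_lie, e0_lie_levi, map_sum]
  have : ∑ j, UniversalEnvelopingAlgebra.ι ℂ (A k j • e0 m j) =
      ∑ j, A k j • (UniversalEnvelopingAlgebra.ι ℂ (e0 m j) - 1) := by
    simp [smul_sub, Finset.sum_sub_distrib, ← Finset.sum_smul, hA]
  rw [this]
  exact sum_mem fun j _ => (whittakerIdeal m).smul_of_tower_mem (A k j) (e0_sub_one_mem m j)

/-- The element `e_{i0} + ∑_j e_{ij} (h_j - 1)` of `U(p_n)`. -/
def omega (i : Fin (m + 1)) : UniversalEnvelopingAlgebra ℂ (parabolic m) :=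
  UniversalEnvelopingAlgebra.ι ℂ (f0 m i) +
    ∑ j, UniversalEnvelopingAlgebra.ι ℂ (levi m (Matrix.single i j 1)) *
      (UniversalEnvelopingAlgebra.ι ℂ (levi m (Matrix.single j j 1)) - 1)

lemma levi_one : (levi m 1 : sl m) = ∑ j, (levi m (Matrix.single j j 1) : sl m) := by
  apply Subtype.ext
  ext a b
  refine Fin.cases ?_ (fun a => ?_) a <;> refine Fin.cases ?_ (fun b => ?_) b
  · simp [levi, Matrix.sum_apply]
    ring
  · simp [levi, Matrix.sum_apply]
  · simp [levi, Matrix.sum_apply]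
  · simp [levi, Matrix.sum_apply, Matrix.one_apply, Matrix.single_apply, ite_and]
    by_cases h : a = b
    · simp [h]
      ring
    · simp [h]

lemma omega_mem (i : Fin (m + 1)) : omega m i ∈ WAlg m := by
  intro k
  have hl (a b : Fin (m + 1)) :
      UniversalEnvelopingAlgebra.ι ℂ (e0 m k) *
        UniversalEnvelopingAlgebra.ι ℂ (levi m (Matrix.single a b 1) : sl m) =
      UniversalEnvelopingAlgebra.ι ℂ (levi m (Matrix.single a b 1) : sl m) *
        UniversalEnvelopingAlgebra.ι ℂ (e0 m k) +
        if a = k then UniversalEnvelopingAlgebra.ι ℂ (e0 m b) else 0 := by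
    rw [← sub_eq_iff_eq_add', ← Ring.lie_def, ← LieHom.map_lie, e0_lie_levi]
    by_cases h : a = k <;> simp [Matrix.single_apply, h]
  have hf : UniversalEnvelopingAlgebra.ι ℂ (e0 m k) *
        UniversalEnvelopingAlgebra.ι ℂ (f0 m i : sl m) =
      UniversalEnvelopingAlgebra.ι ℂ (f0 m i : sl m) * UniversalEnvelopingAlgebra.ι ℂ (e0 m k) +
      (-UniversalEnvelopingAlgebra.ι ℂ (levi m (Matrix.single i k 1) : sl m) -
        if i = k then ∑ j, UniversalEnvelopingAlgebra.ι ℂ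
          (levi m (Matrix.single j j 1) : sl m) else 0) := by
    rw [← sub_eq_iff_eq_add', ← Ring.lie_def, ← LieHom.map_lie, e0_lie_f0, levi_one]
    by_cases h : i = k <;> simp [h]
  simp only [omega, map_add, map_sum, map_mul, map_sub, map_one, inclU_ι]
  set e : Fin (m + 1) → UniversalEnvelopingAlgebra ℂ (sl m) :=
    fun i => UniversalEnvelopingAlgebra.ι ℂ (e0 m i) with he
  set L : Fin (m + 1) → Fin (m + 1) → UniversalEnvelopingAlgebra ℂ (sl m) :=
    fun a b => UniversalEnvelopingAlgebra.ι ℂ (levi m (Matrix.single a b 1) : sl m) with hL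
  set f := UniversalEnvelopingAlgebra.ι ℂ (f0 m i : sl m)
  have hl (a b : Fin (m + 1)) : e k * L a b = L a b * e k + if a = k then e b else 0 := hl a b
  have hf : e k * f = f * e k + (-L i k - if i = k then ∑ j, L j j else 0) := hf
  change e k * (f + ∑ j, L i j * (L j j - 1)) - (f + ∑ j, L i j * (L j j - 1)) * e k ∈ _
  have hj (j : Fin (m + 1)) : e k * (L i j * (L j j - 1)) =
      L i j * (L j j - 1) * e k + (if j = k then L i k * e k else 0) +
        if i = k then L j j * e j else 0 := by
    have h1 := hl j j
    have h2 : e j * L j j = L j j * e j + e j := by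
      rw [he, hL, ← sub_eq_iff_eq_add', ← Ring.lie_def, ← LieHom.map_lie, e0_lie_levi]
      simp [Matrix.single_apply]
    rw [← mul_assoc, hl, add_mul, mul_assoc (L i j), mul_sub (e k), h1]
    by_cases h4 : j = k
    · subst h4
      by_cases h3 : i = j
      · simp [h3, mul_sub, sub_mul, h2, mul_assoc]
      · simp [h3, mul_sub, sub_mul, mul_assoc]
    · by_cases h3 : i = k
      · simp [h3, h4, mul_sub, sub_mul, h2, mul_assoc]
      · simp [h3, h4, mul_sub, sub_mul, mul_assoc]
  have key : e k * (f + ∑ j, L i j * (L j j - 1)) - (f + ∑ j, L i j * (L j j - 1)) * e k =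
      L i k * (e k - 1) + ∑ j, if i = k then L j j * (e j - 1) else 0 := by
    rw [mul_add, hf, Finset.mul_sum, Finset.sum_congr rfl fun j _ => hj j, add_mul, Finset.sum_mul]
    simp only [Finset.sum_add_distrib, Finset.sum_ite_eq', Finset.mem_univ, if_true]
    by_cases h3 : i = k
    · simp only [h3, if_true, mul_sub, mul_one, Finset.sum_sub_distrib]
      abel
    · simp only [h3, if_false, Finset.sum_const_zero, mul_sub, mul_one]
      abel
  rw [key]
  refine add_mem (mul_e0_sub_mem m _ _) (sum_mem fun j _ => ?_)
  split_ifs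
  · exact mul_e0_sub_mem m _ _
  · exact zero_mem _

lemma sigma_ι (A : gl m) : sigma m (UniversalEnvelopingAlgebra.ι ℂ A) =
    UniversalEnvelopingAlgebra.ι ℂ (sigmaLie m A) := by
  rw [sigma, UniversalEnvelopingAlgebra.lift_ι_apply]
  rfl

lemma ι_sigmaLie_mem (A : gl m) (hA : ∀ i, ∑ j, A i j = 0) :
    UniversalEnvelopingAlgebra.ι ℂ (sigmaLie m A) ∈ sigmaTauW m := by
  refine ⟨⟨_, levi_mem m A hA⟩, ?_⟩
  change sigma m (tau m _) = _
  rw [← sigma_ι, tau]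
  change sigma m (UniversalEnvelopingAlgebra.lift ℂ
    ((UniversalEnvelopingAlgebra.ι ℂ).comp (leviProj m)) (UniversalEnvelopingAlgebra.ι ℂ _)) = _
  rw [UniversalEnvelopingAlgebra.lift_ι_apply, LieHom.comp_apply]
  congr 2
  exact leviProj_levi m A

lemma sigma_gamma_mem (i : Fin (m + 1)) :
    ∑ j, sigma m (E m i j) * (sigma m (E m j j) - 1) ∈ sigmaTauW m := by
  refine ⟨⟨_, omega_mem m i⟩, ?_⟩
  have h (x : parabolic m) : UniversalEnvelopingAlgebra.lift ℂ
    ((UniversalEnvelopingAlgebra.ι ℂ).comp (leviProj m)) (UniversalEnvelopingAlgebra.ι ℂ x) =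
      UniversalEnvelopingAlgebra.ι ℂ (leviProj m x) := by
    rw [UniversalEnvelopingAlgebra.lift_ι_apply]
    rfl
  change sigma m (UniversalEnvelopingAlgebra.lift ℂ
    ((UniversalEnvelopingAlgebra.ι ℂ).comp (leviProj m)) (omega m i)) = _
  rw [omega]
  simp only [map_add, map_sum, map_mul, map_sub, map_one, h, leviProj_levi, leviProj_f0, map_zero,
    zero_add]
  rfl


lemma single_mul_X (i : Fin (m + 1)) (j : Fin m) :
    Matrix.single i j.castSucc (1 : ℂ) * X m = Matrix.single i (Fin.last m) 1 := by
  rw [X, Finset.mul_sum, Finset.sum_eq_single j]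
  · simp
  · intro k _ hk
    rw [Matrix.single_mul_single_of_ne]
    exact fun h => hk (Fin.castSucc_injective m h).symm
  · simp

lemma single_last_mul_X (i : Fin (m + 1)) :
    Matrix.single i (Fin.last m) (1 : ℂ) * X m = 0 := by
  rw [X, Finset.mul_sum]
  refine Finset.sum_eq_zero fun k _ => ?_
  rw [Matrix.single_mul_single_of_ne]
  exact (Fin.castSucc_lt_last k).ne'

lemma X_mul_single (i : Fin m) (j : Fin (m + 1)) :
    X m * Matrix.single i.castSucc j (1 : ℂ) = 0 := by
  rw [X, Finset.sum_mul]
  refine Finset.sum_eq_zero fun k _ => ?_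
  rw [Matrix.single_mul_single_of_ne]
  exact (Fin.castSucc_lt_last i).ne'

lemma X_mul_single_last (j : Fin (m + 1)) :
    X m * Matrix.single (Fin.last m) j (1 : ℂ) = ∑ k : Fin m, Matrix.single k.castSucc j 1 := by
  rw [X, Finset.sum_mul]
  simp

lemma sigmaLie_single (i j : Fin m) :
    sigmaLie m (Matrix.single i.castSucc j.castSucc 1) =
      Matrix.single i.castSucc j.castSucc 1 + Matrix.single i.castSucc (Fin.last m) 1 := by
  rw [sigmaLie_apply, X_mul_single, single_mul_X]
  simp

lemma sigmaLie_single_last (i : Fin m) :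
    sigmaLie m (Matrix.single i.castSucc (Fin.last m) 1) =
      Matrix.single i.castSucc (Fin.last m) 1 := by
  rw [sigmaLie_apply, X_mul_single, single_last_mul_X]
  simp

lemma sigmaLie_last_last :
    sigmaLie m (Matrix.single (Fin.last m) (Fin.last m) 1) =
      Matrix.single (Fin.last m) (Fin.last m) 1 - X m := by
  rw [sigmaLie_apply, mul_assoc, single_last_mul_X, X_mul_single_last, X]
  simp [sub_eq_add_neg]

lemma sigmaLie_col (j : Fin m) :
    sigmaLie m (∑ i, Matrix.single i j.castSucc 1) =
      Matrix.single (Fin.last m) j.castSucc 1 + Matrix.single (Fin.last m) (Fin.last m) 1 := by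
  rw [sigmaLie_apply, Fin.sum_univ_castSucc]
  simp only [add_mul, mul_add, Finset.sum_mul, Finset.mul_sum, X_mul_single, single_mul_X,
    X_mul_single_last, Finset.sum_const_zero, zero_mul]
  abel

lemma sigmaLie_col_last :
    sigmaLie m (∑ i, Matrix.single i (Fin.last m) 1) =
      Matrix.single (Fin.last m) (Fin.last m) 1 := by
  rw [Fin.sum_univ_castSucc, map_add, map_sum, sigmaLie_last_last, X]
  simp [sigmaLie_single_last]

lemma E_mem (i j : Fin m) : E m i.castSucc j.castSucc ∈ sigmaTauW m := by
  have h := ι_sigmaLie_mem m (Matrix.single i.castSucc j.castSucc 1 -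
    Matrix.single i.castSucc (Fin.last m) 1) (by
      intro a
      by_cases h : i.castSucc = a <;> simp [Matrix.single_apply, h])
  rw [map_sub, sigmaLie_single, sigmaLie_single_last, add_sub_cancel_right] at h
  exact h

lemma E_last_mem (j : Fin m) : E m (Fin.last m) j.castSucc ∈ sigmaTauW m := by
  have h := ι_sigmaLie_mem m (∑ i, Matrix.single i j.castSucc 1 -
    ∑ i, Matrix.single i (Fin.last m) 1) (by
      intro a
      simp [Matrix.sum_apply, Matrix.single_apply, ite_and])
  rw [map_sub, sigmaLie_col, sigmaLie_col_last, add_sub_cancel_right] at h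
  exact h

lemma y_mem_aux (k : Fin (m + 1)) (hE : ∀ j : Fin m, E m k j.castSucc ∈ sigmaTauW m)
    (h : ∑ j : Fin m, (E m k j.castSucc + E m k (Fin.last m)) *
        (E m j.castSucc j.castSucc + E m j.castSucc (Fin.last m) - 1) +
      E m k (Fin.last m) * (E m (Fin.last m) (Fin.last m) -
        ∑ j : Fin m, E m j.castSucc (Fin.last m) - 1) ∈ sigmaTauW m) :
    y m k ∈ sigmaTauW m := by
  have h1 : ∑ j : Fin m, E m k j.castSucc * (E m j.castSucc j.castSucc - 1) ∈ sigmaTauW m :=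
    sum_mem fun j _ => mul_mem (hE j) (sub_mem (E_mem m j j) (one_mem _))
  have h2 := sub_mem h h1
  convert h2 using 1
  rw [y, Fin.sum_univ_castSucc]
  simp only [add_mul, mul_add, mul_sub, mul_one, Finset.sum_add_distrib, Finset.sum_sub_distrib,
    Finset.mul_sum, Finset.sum_const, Finset.card_univ, Fintype.card_fin, Nat.cast_add,
    Nat.cast_one, nsmul_eq_mul, (Nat.cast_commute m _).eq]
  abel

lemma y_mem (k : Fin (m + 1)) : y m k ∈ sigmaTauW m := by
  have hX : UniversalEnvelopingAlgebra.ι ℂ (X m) = ∑ j : Fin m, E m j.castSucc (Fin.last m) := by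
    simp [X, E]
  have hd (j : Fin m) : sigma m (E m j.castSucc j.castSucc) =
      E m j.castSucc j.castSucc + E m j.castSucc (Fin.last m) := by
    rw [E, sigma_ι, sigmaLie_single, map_add]
    rfl
  have hn : sigma m (E m (Fin.last m) (Fin.last m)) =
      E m (Fin.last m) (Fin.last m) - ∑ j : Fin m, E m j.castSucc (Fin.last m) := by
    rw [E, sigma_ι, sigmaLie_last_last, map_sub, hX]
  induction k using Fin.lastCases with
  | last =>
    refine y_mem_aux m _ (E_last_mem m) ?_
    have h := sum_mem (S := sigmaTauW m) fun i (_ : i ∈ Finset.univ) => sigma_gamma_mem m i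
    rw [Finset.sum_comm, Fin.sum_univ_castSucc] at h
    simp only [← Finset.sum_mul, ← map_sum] at h
    have hc (j : Fin (m + 1)) : sigma m (∑ i, E m i j) =
        UniversalEnvelopingAlgebra.ι ℂ (sigmaLie m (∑ i, Matrix.single i j 1)) := by
      rw [← sigma_ι, map_sum (UniversalEnvelopingAlgebra.ι ℂ)]
      rfl
    simp only [hc, sigmaLie_col, sigmaLie_col_last, hd, hn, map_add] at h
    exact h
  | cast k =>
    refine y_mem_aux m _ (E_mem m k) ?_
    have h := sigma_gamma_mem m k.castSucc
    rw [Fin.sum_univ_castSucc] at h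
    have h1 (j : Fin m) : sigma m (E m k.castSucc j.castSucc) =
        E m k.castSucc j.castSucc + E m k.castSucc (Fin.last m) := by
      rw [E, sigma_ι, sigmaLie_single, map_add]
      rfl
    have h2 : sigma m (E m k.castSucc (Fin.last m)) = E m k.castSucc (Fin.last m) := by
      rw [E, sigma_ι, sigmaLie_single_last]
    simp only [h1, h2, hd, hn] at h
    exact h

/-- `e_{ij}`, `1 ≤ i, j ≤ n - 1`, as an element of `στ(W)`. -/
def eW (i j : Fin m) : sigmaTauW m := ⟨E m i.castSucc j.castSucc, E_mem m i j⟩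

/-- `y_k`, `1 ≤ k ≤ n`, as an element of `στ(W)`. -/
def yW (k : Fin (m + 1)) : sigmaTauW m := ⟨y m k, y_mem m k⟩

/-- `στ(W)⁺`: the (non-unital) subalgebra of `στ(W)` generated by `y_1, …, y_{n-1}` and the
`e_{ij}`, `1 ≤ i < j ≤ n - 1`. -/
def sigmaTauWPlus : NonUnitalSubalgebra ℂ (sigmaTauW m) :=
  NonUnitalAlgebra.adjoin ℂ
    ({x | ∃ k : Fin m, x = yW m k.castSucc} ∪ {x | ∃ i j : Fin m, i < j ∧ x = eW m i j})

/-- The left ideal of `στ(W)` generated by `στ(W)⁺`, `y_n - η_n` and `e_{ii} - λ_i`,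
`i = 1, …, n - 1`. -/
def vermaIdeal (lam : Fin m → ℂ) (eta : ℂ) : Submodule (sigmaTauW m) (sigmaTauW m) :=
  Submodule.span (sigmaTauW m)
    ((sigmaTauWPlus m : Set (sigmaTauW m)) ∪
      {yW m (Fin.last m) - algebraMap ℂ (sigmaTauW m) eta} ∪
      {x | ∃ i : Fin m, x = eW m i i - algebraMap ℂ (sigmaTauW m) (lam i)})

/-- The Verma module `M(λ_1, …, λ_{n-1}, η_n)` over `στ(W)`. -/
abbrev Verma (lam : Fin m → ℂ) (eta : ℂ) : Type :=
  sigmaTauW m ⧸ vermaIdeal m lam eta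

end FiniteW

end

/-! The class `v` of `1` in the quotient is a highest weight vector, and both conclusions come from
running an `sl_2`-style argument on `v`. If `f` lowers the weights of `v` for an operator `h` and `e
(f^(k+1) v) = c k • f^k v`, then finite dimension forces `c k = 0` for some `k`
(`exists_ladder_coeff_eq_zero`).

For `i < j ≤ n-1`, taking `e = e_{ij}`, `f = e_{ji}`, `h = e_{ii}` gives `c k = (k+1)(λ_i - λ_j -
k)`, so `λ_i - λ_j` is a natural number (`exists_sub_eq_natCast`).

For `η_n`, put `a = n-1` and take `e = y_a`, `f = e_{na}`, `h = e_{aa}`. The commutators of `e_{na}`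
with `y_a` and `y_n` (`E_last_mul_y`, `E_last_mul_y_last`) involve only elements of `στ(W)`. Since
`a` is the largest index, they act on the powers `f^k v` by explicit scalars, and summing these
gives `c k = -(k+1)(η_n - (λ_a - k)(∑ λ_j - n + λ_a - k))` (`yW_smul_lastW_pow_succ_smul`). Its
vanishing is the asserted formula (`exists_eta_eq`). -/

theorem exists_ladder_coeff_eq_zero {V : Type*} [AddCommGroup V] [Module ℂ V]
    [FiniteDimensional ℂ V] {v : V} (hv : v ≠ 0) (e f h : Module.End ℂ V) {w : ℕ → ℂ}
    (hw : Function.Injective w) (hh : ∀ k, h ((f ^ k) v) = w k • (f ^ k) v) {c : ℕ → ℂ}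
    (he : ∀ k, e ((f ^ (k + 1)) v) = c k • (f ^ k) v) : ∃ k, c k = 0 := by
  -- Otherwise every `(f ^ k) v` is an eigenvector of `h`, and injectivity of `w` yields infinitely
  -- many eigenvalues in finite dimension.
  have hex : ∃ k, (f ^ k) v = 0 := by
    by_contra! hne
    have hev : ∀ k, h.HasEigenvalue (w k) := fun k =>
      Module.End.hasEigenvalue_of_hasEigenvector
        (Module.End.hasEigenvector_iff.2 ⟨Module.End.mem_eigenspace_iff.2 (hh k), hne k⟩)
    exact Set.infinite_range_of_injective hw
      ((Module.End.finite_hasEigenvalue h).subset (Set.range_subset_iff.2 hev))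
  classical
  -- The first vanishing power is not the zeroth because `v ≠ 0`; its predecessor is the `k` sought.
  obtain ⟨k, hk, hmin⟩ : ∃ k, (f ^ (k + 1)) v = 0 ∧ (f ^ k) v ≠ 0 := by
    have h0 := Nat.find_spec hex
    obtain ⟨k, hk⟩ := Nat.exists_eq_succ_of_ne_zero (n := Nat.find hex) (by
      intro h; rw [h] at h0; exact hv h0)
    refine ⟨k, by rw [hk] at h0; exact h0, Nat.find_min hex (by omega)⟩
  refine ⟨k, (smul_eq_zero.1 ?_).resolve_right hmin⟩
  rw [← he, hk, map_zero]

namespace FiniteW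

attribute [local instance 100] LieRing.ofAssociativeRing

variable (m : ℕ)

/-! ### Commutation relations in `U(gl_n)` -/

lemma E_mul_E (i j k l : Fin (m + 1)) :
    E m i j * E m k l = E m k l * E m i j + (if j = k then E m i l else 0) -
      if l = i then E m k j else 0 := by
  have h : ⁅(Matrix.single i j 1 : gl m), Matrix.single k l (1 : ℂ)⁆ =
      (if j = k then Matrix.single i l 1 else 0) -
        if l = i then Matrix.single k j 1 else 0 := by
    rw [Ring.lie_def]
    congr 1
    · split_ifs with h
      · subst h; simp
      · rw [Matrix.single_mul_single_of_ne _ _ _ _ h]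
    · split_ifs with h
      · subst h; simp
      · rw [Matrix.single_mul_single_of_ne _ _ _ _ h]
  have h2 := congrArg (UniversalEnvelopingAlgebra.ι ℂ) h
  rw [LieHom.map_lie, Ring.lie_def, map_sub] at h2
  rw [add_sub_assoc, ← sub_eq_iff_eq_add']
  refine h2.trans ?_
  congr 1 <;> split_ifs <;> simp [E]

/-- The identity matrix is central in `gl_n`; this instance lets `e_{na}` move past the factor `I_n
- n` of `y_k`. -/
lemma E_last_mul_sum (a : Fin m) :
    E m (Fin.last m) a.castSucc * ∑ i, E m i i =
      (∑ i, E m i i) * E m (Fin.last m) a.castSucc := by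
  simp only [Finset.mul_sum, E_mul_E m (Fin.last m) a.castSucc, Finset.sum_add_distrib,
    Finset.sum_sub_distrib, Finset.sum_mul, Finset.sum_ite_eq, Finset.sum_ite_eq',
    Finset.mem_univ, if_true]
  abel

lemma E_last_mul_E_last (a j : Fin m) :
    E m (Fin.last m) a.castSucc * E m j.castSucc (Fin.last m) =
      E m j.castSucc (Fin.last m) * E m (Fin.last m) a.castSucc +
        (if a = j then E m (Fin.last m) (Fin.last m) else 0) - E m j.castSucc a.castSucc := by
  rw [E_mul_E]
  simp

/-- Commuting `e_{na}` past the index `a` in `e_{an}` and `e_{aj}` replaces it by `n`, which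
assembles `y_n`; what remains lies in `U(gl_{n-1})`. This nonlinear relation plays the part of `[f,
e]` in the second ladder. -/
lemma E_last_mul_y (a : Fin m) :
    E m (Fin.last m) a.castSucc * y m a.castSucc =
      y m a.castSucc * E m (Fin.last m) a.castSucc + y m (Fin.last m) -
        ∑ j : Fin m, E m a.castSucc j.castSucc * E m j.castSucc a.castSucc -
        E m a.castSucc a.castSucc * (∑ j : Fin m, E m j.castSucc j.castSucc -
          ((m + 1 : ℕ) : UniversalEnvelopingAlgebra ℂ (gl m))) := by
  have hs (j : Fin m) : E m (Fin.last m) a.castSucc *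
      (E m a.castSucc j.castSucc * E m j.castSucc (Fin.last m)) =
      E m a.castSucc j.castSucc * E m j.castSucc (Fin.last m) * E m (Fin.last m) a.castSucc +
        E m (Fin.last m) j.castSucc * E m j.castSucc (Fin.last m) +
        (if a = j then E m a.castSucc a.castSucc * E m (Fin.last m) (Fin.last m) else 0) -
        E m a.castSucc j.castSucc * E m j.castSucc a.castSucc := by
    rw [← mul_assoc, E_mul_E m (Fin.last m) a.castSucc a.castSucc,
      if_pos rfl, if_neg (Fin.castSucc_lt_last j).ne, sub_zero, add_mul,
      mul_assoc (E m a.castSucc j.castSucc), E_last_mul_E_last m a j, mul_sub, mul_add, ← mul_assoc]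
    by_cases h : a = j
    · subst h; simp only [if_true]; abel
    · simp only [h, if_false, mul_zero]; abel
  have hf : E m (Fin.last m) a.castSucc * (E m a.castSucc (Fin.last m) *
      (∑ i, E m i i - ((m + 1 : ℕ) : UniversalEnvelopingAlgebra ℂ (gl m)))) =
      E m a.castSucc (Fin.last m) *
        (∑ i, E m i i - ((m + 1 : ℕ) : UniversalEnvelopingAlgebra ℂ (gl m))) *
          E m (Fin.last m) a.castSucc +
      (E m (Fin.last m) (Fin.last m) - E m a.castSucc a.castSucc) *
        (∑ i, E m i i - ((m + 1 : ℕ) : UniversalEnvelopingAlgebra ℂ (gl m))) := by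
    rw [← mul_assoc, E_last_mul_E_last, if_pos rfl, mul_assoc _ _ (E m (Fin.last m) a.castSucc),
      sub_mul _ _ (E m (Fin.last m) a.castSucc), ← E_last_mul_sum, Nat.cast_comm, ← mul_sub,
      add_sub_assoc, add_mul, mul_assoc]
  rw [y, y, mul_add, hf, Finset.mul_sum, Finset.sum_congr rfl fun j _ => hs j]
  simp only [Finset.sum_add_distrib, Finset.sum_sub_distrib, Finset.sum_ite_eq, Finset.mem_univ,
    if_true, add_mul, Finset.sum_mul]
  -- Splitting `e_{nn}` off the trace makes `e_{aa} e_{nn}` cancel the diagonal term from `hs`.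
  rw [Fin.sum_univ_castSucc fun i => E m i i]
  simp only [sub_mul, mul_sub, mul_add]
  abel

/-- Needed because `y_n` occurs in the previous relation: its action must be carried along the
powers of `e_{na}`. -/
lemma E_last_mul_y_last (a : Fin m) :
    E m (Fin.last m) a.castSucc * y m (Fin.last m) =
      y m (Fin.last m) * E m (Fin.last m) a.castSucc -
        ∑ j : Fin m, E m (Fin.last m) j.castSucc * E m j.castSucc a.castSucc -
        E m (Fin.last m) a.castSucc * (∑ j : Fin m, E m j.castSucc j.castSucc -
          ((m + 1 : ℕ) : UniversalEnvelopingAlgebra ℂ (gl m))) := by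
  have hs (j : Fin m) : E m (Fin.last m) a.castSucc *
      (E m (Fin.last m) j.castSucc * E m j.castSucc (Fin.last m)) =
      E m (Fin.last m) j.castSucc * E m j.castSucc (Fin.last m) * E m (Fin.last m) a.castSucc +
        (if a = j then E m (Fin.last m) a.castSucc * E m (Fin.last m) (Fin.last m) else 0) -
        E m (Fin.last m) j.castSucc * E m j.castSucc a.castSucc := by
    rw [← mul_assoc, E_mul_E m (Fin.last m) a.castSucc (Fin.last m),
      if_neg (Fin.castSucc_lt_last a).ne, if_neg (Fin.castSucc_lt_last j).ne, sub_zero, add_zero,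
      mul_assoc (E m (Fin.last m) j.castSucc), E_last_mul_E_last m a j, mul_sub, mul_add,
      ← mul_assoc]
    by_cases h : a = j
    · subst h; simp only [if_true]
    · simp only [h, if_false, mul_zero]
  have hf : E m (Fin.last m) a.castSucc * (E m (Fin.last m) (Fin.last m) *
      (∑ i, E m i i - ((m + 1 : ℕ) : UniversalEnvelopingAlgebra ℂ (gl m)))) =
      E m (Fin.last m) (Fin.last m) *
        (∑ i, E m i i - ((m + 1 : ℕ) : UniversalEnvelopingAlgebra ℂ (gl m))) *
          E m (Fin.last m) a.castSucc -
      E m (Fin.last m) a.castSucc *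
        (∑ i, E m i i - ((m + 1 : ℕ) : UniversalEnvelopingAlgebra ℂ (gl m))) := by
    rw [← mul_assoc, E_mul_E m (Fin.last m) a.castSucc (Fin.last m),
      if_neg (Fin.castSucc_lt_last _).ne, if_pos rfl, add_zero,
      mul_assoc _ _ (E m (Fin.last m) a.castSucc),
      sub_mul _ _ (E m (Fin.last m) a.castSucc), ← E_last_mul_sum, Nat.cast_comm, ← mul_sub,
      sub_mul, mul_assoc]
  rw [y, mul_add, hf, Finset.mul_sum, Finset.sum_congr rfl fun j _ => hs j]
  simp only [Finset.sum_add_distrib, Finset.sum_sub_distrib, Finset.sum_ite_eq, Finset.mem_univ,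
    if_true, add_mul, Finset.sum_mul]
  rw [Fin.sum_univ_castSucc fun i => E m i i]
  simp only [mul_sub, mul_add]
  abel

/-! ### The same relations inside `στ(W)` -/

/-- `e_{nj}`, `1 ≤ j ≤ n - 1`, as an element of `στ(W)`. -/
def lastW (j : Fin m) : sigmaTauW m := ⟨E m (Fin.last m) j.castSucc, E_last_mem m j⟩

lemma lastW_mul_yW (a : Fin m) :
    lastW m a * yW m a.castSucc = yW m a.castSucc * lastW m a + yW m (Fin.last m) -
      ∑ j, eW m a j * eW m j a - eW m a a * (∑ j, eW m j j - ((m + 1 : ℕ) : sigmaTauW m)) := by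
  apply Subtype.ext
  simpa [lastW, yW, eW] using E_last_mul_y m a

lemma lastW_mul_yW_last (a : Fin m) :
    lastW m a * yW m (Fin.last m) = yW m (Fin.last m) * lastW m a -
      ∑ j, lastW m j * eW m j a - lastW m a * (∑ j, eW m j j - ((m + 1 : ℕ) : sigmaTauW m)) := by
  apply Subtype.ext
  simpa [lastW, yW, eW] using E_last_mul_y_last m a

lemma eW_mul_eW (i j k l : Fin m) :
    eW m i j * eW m k l = eW m k l * eW m i j + (if j = k then eW m i l else 0) -
      if l = i then eW m k j else 0 := by
  apply Subtype.ext
  refine (E_mul_E m i.castSucc j.castSucc k.castSucc l.castSucc).trans ?_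
  simp only [Fin.castSucc_inj]
  split_ifs <;> simp [eW]

lemma eW_mul_lastW (i j k : Fin m) :
    eW m i j * lastW m k = lastW m k * eW m i j - if k = i then lastW m j else 0 := by
  apply Subtype.ext
  refine (E_mul_E m i.castSucc j.castSucc (Fin.last m) k.castSucc).trans ?_
  simp only [Fin.castSucc_inj, (Fin.castSucc_lt_last _).ne, if_false, add_zero]
  split_ifs <;> simp [eW, lastW]

/-! ### Highest weight vectors -/

/-- The relations satisfied by a highest weight vector of weight `(λ_1, …, λ_{n-1}, η_n)` in a
`στ(W)`-module. -/
structure IsHighestWeightVector {V : Type*} [AddCommGroup V] [Module ℂ V]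
    [Module (sigmaTauW m) V] (lam : Fin m → ℂ) (eta : ℂ) (v : V) : Prop where
  ne_zero : v ≠ 0
  eW_diag_smul (i : Fin m) : eW m i i • v = lam i • v
  yW_last_smul : yW m (Fin.last m) • v = eta • v
  yW_smul (k : Fin m) : yW m k.castSucc • v = 0
  eW_smul (i j : Fin m) (hij : i < j) : eW m i j • v = 0

/-- An element `x` sends the class of `1` to the class of `x`, so the generators of the left ideal
give the relations. The class is nonzero because it generates the quotient and `N` is proper. -/
lemma isHighestWeightVector_mk (lam : Fin m → ℂ) (eta : ℂ)
    (N : Submodule (sigmaTauW m) (Verma m lam eta)) (hN : N ≠ ⊤) :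
    IsHighestWeightVector m lam eta
      (N.mkQ ((vermaIdeal m lam eta).mkQ 1)) := by
  have key (x : sigmaTauW m) (hx : x ∈ vermaIdeal m lam eta) :
      x • N.mkQ ((vermaIdeal m lam eta).mkQ 1) = 0 := by
    rw [← map_smul, ← map_smul, smul_eq_mul, mul_one, Submodule.mkQ_apply _ x,
      (Submodule.Quotient.mk_eq_zero _).2 hx, map_zero]
  have key' (x : sigmaTauW m) (c : ℂ)
      (hx : x - algebraMap ℂ (sigmaTauW m) c ∈ vermaIdeal m lam eta) :
      x • N.mkQ ((vermaIdeal m lam eta).mkQ 1) = c • N.mkQ ((vermaIdeal m lam eta).mkQ 1) := by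
    rw [← sub_eq_zero, ← algebraMap_smul (sigmaTauW m) c, ← sub_smul]
    exact key _ hx
  refine ⟨fun h => hN ?_, fun i => key' _ _ ?_, key' _ _ ?_, fun k => key _ ?_,
    fun i j hij => key _ ?_⟩
  · refine eq_top_iff.2 fun x _ => ?_
    obtain ⟨x, rfl⟩ := Submodule.mkQ_surjective _ x
    rw [← mul_one x, ← smul_eq_mul, map_smul]
    exact N.smul_mem x ((Submodule.Quotient.mk_eq_zero N).1 h)
  · exact Submodule.subset_span (Or.inr ⟨i, rfl⟩)
  · exact Submodule.subset_span (Or.inl (Or.inr rfl))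
  · exact Submodule.subset_span (Or.inl (Or.inl
      (NonUnitalAlgebra.subset_adjoin ℂ (Or.inl ⟨k, rfl⟩))))
  · exact Submodule.subset_span (Or.inl (Or.inl
      (NonUnitalAlgebra.subset_adjoin ℂ (Or.inr ⟨i, j, hij, rfl⟩))))

namespace IsHighestWeightVector

variable {m} {V : Type*} [AddCommGroup V] [Module ℂ V] [Module (sigmaTauW m) V]
  {lam : Fin m → ℂ} {eta : ℂ} {v : V}

/-- For `i ≠ a` the elements `e_{ia}` and `e_{na}` commute, so the vanishing on `v` persists. -/
lemma eW_smul_lastW_pow_smul (hv : IsHighestWeightVector m lam eta v) {i a : Fin m} (hia : i < a)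
    (k : ℕ) : eW m i a • lastW m a ^ k • v = 0 := by
  induction k with
  | zero => simp [hv.eW_smul i a hia]
  | succ k ih =>
    rw [pow_succ', mul_smul, ← mul_smul, eW_mul_lastW, if_neg hia.ne', sub_zero, mul_smul, ih,
      smul_zero]

/-! ### The `gl_{n-1}` ladder and the differences of the `λ_i` -/

variable [IsScalarTower ℂ (sigmaTauW m) V]

lemma eW_diag_smul_eW_pow_smul (hv : IsHighestWeightVector m lam eta v) {i j : Fin m}
    (hij : i ≠ j) (k : ℕ) : eW m i i • eW m j i ^ k • v = (lam i - k) • eW m j i ^ k • v := by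
  induction k with
  | zero => simp [hv.eW_diag_smul]
  | succ k ih =>
    have h : eW m i i * eW m j i = eW m j i * eW m i i - eW m j i := by
      simp [eW_mul_eW m i i, hij]
    rw [pow_succ', mul_smul, ← mul_smul, h, sub_smul, mul_smul, ih,
      smul_comm _ (_ : ℂ)]
    generalize eW m j i • eW m j i ^ k • v = u
    push_cast
    module

lemma eW_diag_smul_eW_pow_smul' (hv : IsHighestWeightVector m lam eta v) {i j : Fin m}
    (hij : i ≠ j) (k : ℕ) : eW m j j • eW m j i ^ k • v = (lam j + k) • eW m j i ^ k • v := by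
  induction k with
  | zero => simp [hv.eW_diag_smul]
  | succ k ih =>
    have h : eW m j j * eW m j i = eW m j i * eW m j j + eW m j i := by
      simp [eW_mul_eW m j j, hij]
    rw [pow_succ', mul_smul, ← mul_smul, h, add_smul, mul_smul, ih,
      smul_comm _ (_ : ℂ)]
    generalize eW m j i • eW m j i ^ k • v = u
    push_cast
    module

/-- The usual `sl_2` computation: the commutator contributes `λ_i - λ_j - 2l` at level `l`, and the
sum over `l ≤ k` is the stated coefficient. -/
lemma eW_smul_eW_pow_succ_smul (hv : IsHighestWeightVector m lam eta v) {i j : Fin m}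
    (hij : i < j) (k : ℕ) : eW m i j • eW m j i ^ (k + 1) • v =
      ((k + 1 : ℂ) * (lam i - lam j - k)) • eW m j i ^ k • v := by
  have h : eW m i j * eW m j i = eW m j i * eW m i j + eW m i i - eW m j j := by
    simp [eW_mul_eW m i j]
  have hstep (k : ℕ) : eW m i j • eW m j i ^ (k + 1) • v =
      eW m j i • eW m i j • eW m j i ^ k • v + (lam i - lam j - 2 * k) • eW m j i ^ k • v := by
    rw [pow_succ', mul_smul, ← mul_smul, h, sub_smul, add_smul, mul_smul,
      hv.eW_diag_smul_eW_pow_smul hij.ne, hv.eW_diag_smul_eW_pow_smul' hij.ne]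
    generalize eW m j i ^ k • v = u
    generalize eW m j i • eW m i j • u = w
    module
  induction k with
  | zero =>
    rw [hstep, pow_zero, one_smul, hv.eW_smul i j hij, smul_zero]
    simp
  | succ k ih =>
    rw [hstep, ih, smul_comm, ← mul_smul, ← pow_succ', ← add_smul]
    congr 1
    push_cast
    ring

lemma exists_sub_eq_natCast [FiniteDimensional ℂ V] (hv : IsHighestWeightVector m lam eta v)
    {i j : Fin m} (hij : i < j) : ∃ d : ℕ, lam i - lam j = d := by
  obtain ⟨k, hk⟩ := exists_ladder_coeff_eq_zero hv.ne_zero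
    (Algebra.lsmul ℂ ℂ V (eW m i j)) (Algebra.lsmul ℂ ℂ V (eW m j i))
    (Algebra.lsmul ℂ ℂ V (eW m i i)) (w := fun k => lam i - k)
    (fun a b h => by simpa using h)
    (fun k => by simpa only [← map_pow, Algebra.lsmul_coe] using
      hv.eW_diag_smul_eW_pow_smul hij.ne k)
    (c := fun k => (k + 1 : ℂ) * (lam i - lam j - k))
    (fun k => by simpa only [← map_pow, Algebra.lsmul_coe] using
      hv.eW_smul_eW_pow_succ_smul hij k)
  exact ⟨k, sub_eq_zero.1 ((mul_eq_zero.1 hk).resolve_left (Nat.cast_add_one_ne_zero k))⟩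

/-! ### The ladder of `y_{n-1}` and `e_{n,n-1}` and the value of `η_n` -/

lemma eW_diag_smul_lastW_pow_smul (hv : IsHighestWeightVector m lam eta v) (a i : Fin m) (k : ℕ) :
    eW m i i • lastW m a ^ k • v = (lam i - if a = i then (k : ℂ) else 0) • lastW m a ^ k • v := by
  induction k with
  | zero => simp [hv.eW_diag_smul]
  | succ k ih =>
    rw [pow_succ', mul_smul, ← mul_smul, eW_mul_lastW, sub_smul, mul_smul, ih, smul_comm]
    split_ifs with h
    · subst h
      generalize lastW m a • lastW m a ^ k • v = u
      push_cast
      module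
    · simp

lemma sum_eW_diag_sub_smul_lastW_pow_smul (hv : IsHighestWeightVector m lam eta v) (a : Fin m)
    (k : ℕ) : (∑ j, eW m j j - ((m + 1 : ℕ) : sigmaTauW m)) • lastW m a ^ k • v =
      (∑ j, lam j - k - (m + 1 : ℕ)) • lastW m a ^ k • v := by
  simp only [sub_smul, Finset.sum_smul, hv.eW_diag_smul_lastW_pow_smul, Finset.sum_sub_distrib,
    Nat.cast_smul_eq_nsmul]
  simp [ite_smul, Nat.cast_smul_eq_nsmul]

/-- Maximality of `a` makes every `e_{ja}` with `j ≠ a` a raising element, so only the diagonal term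
survives. This turns the sums in the commutators into scalars. -/
lemma sum_smul_eW_smul_lastW_pow_smul (hv : IsHighestWeightVector m lam eta v) {a : Fin m}
    (ha : ∀ j, j ≤ a) (g : Fin m → sigmaTauW m) (k : ℕ) :
    (∑ j, g j * eW m j a) • lastW m a ^ k • v =
      (lam a - k) • g a • lastW m a ^ k • v := by
  rw [Finset.sum_smul, Finset.sum_eq_single a]
  · rw [mul_smul, hv.eW_diag_smul_lastW_pow_smul, if_pos rfl, smul_comm]
  · intro j _ hj
    rw [mul_smul, hv.eW_smul_lastW_pow_smul (lt_of_le_of_ne (ha j) hj), smul_zero]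
  · simp

/-- Passing from power `l` to `l + 1` adds `(λ_a - l) + (∑ λ_j - l - n)`; summing over `l < k` gives
the quadratic in `k`. -/
lemma yW_last_smul_lastW_pow_smul (hv : IsHighestWeightVector m lam eta v) {a : Fin m}
    (ha : ∀ j, j ≤ a) (k : ℕ) : yW m (Fin.last m) • lastW m a ^ k • v =
      (eta + k * (∑ j, lam j - (m + 1 : ℕ) + lam a) - k * (k - 1)) • lastW m a ^ k • v := by
  induction k with
  | zero => simp [hv.yW_last_smul]
  | succ k ih =>
    have h : yW m (Fin.last m) * lastW m a = lastW m a * yW m (Fin.last m) +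
        ∑ j, lastW m j * eW m j a +
        lastW m a * (∑ j, eW m j j - ((m + 1 : ℕ) : sigmaTauW m)) := by
      rw [lastW_mul_yW_last]
      abel
    rw [pow_succ', mul_smul, ← mul_smul, h, add_smul, add_smul, mul_smul, mul_smul, ih,
      hv.sum_smul_eW_smul_lastW_pow_smul ha, hv.sum_eW_diag_sub_smul_lastW_pow_smul,
      smul_comm (lastW m a) (_ : ℂ), smul_comm (lastW m a) (_ : ℂ)]
    generalize lastW m a • lastW m a ^ k • v = u
    push_cast
    module

lemma yW_smul_lastW_pow_succ_smul (hv : IsHighestWeightVector m lam eta v) {a : Fin m}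
    (ha : ∀ j, j ≤ a) (k : ℕ) : yW m a.castSucc • lastW m a ^ (k + 1) • v =
      (-(k + 1 : ℂ) * (eta - (lam a - k) * (∑ j, lam j - (m + 1 : ℕ) + lam a - k))) •
        lastW m a ^ k • v := by
  have h : yW m a.castSucc * lastW m a = lastW m a * yW m a.castSucc - yW m (Fin.last m) +
      ∑ j, eW m a j * eW m j a +
      eW m a a * (∑ j, eW m j j - ((m + 1 : ℕ) : sigmaTauW m)) := by
    rw [lastW_mul_yW]
    abel
  -- The scalar is `(λ_a - k)^2` from `∑ e_{aj} e_{ja}`, plus `(λ_a - k)(∑ λ_j - k - n)` from the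
  -- trace term, minus the eigenvalue of `y_n`.
  have hstep (k : ℕ) : yW m a.castSucc • lastW m a ^ (k + 1) • v =
      lastW m a • yW m a.castSucc • lastW m a ^ k • v +
      ((lam a - k) * (∑ j, lam j - (m + 1 : ℕ) + lam a - 2 * k) -
        (eta + k * (∑ j, lam j - (m + 1 : ℕ) + lam a) - k * (k - 1))) • lastW m a ^ k • v := by
    rw [pow_succ', mul_smul, ← mul_smul, h, add_smul, add_smul, sub_smul, mul_smul, mul_smul,
      hv.yW_last_smul_lastW_pow_smul ha, hv.sum_smul_eW_smul_lastW_pow_smul ha,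
      hv.sum_eW_diag_sub_smul_lastW_pow_smul, smul_comm (eW m a a) (_ : ℂ),
      hv.eW_diag_smul_lastW_pow_smul, if_pos rfl]
    generalize lastW m a ^ k • v = u
    generalize lastW m a • yW m a.castSucc • u = w
    module
  induction k with
  | zero =>
    rw [hstep, pow_zero, one_smul, hv.yW_smul, smul_zero, zero_add]
    congr 1
    push_cast
    ring
  | succ k ih =>
    rw [hstep, ih, smul_comm, ← mul_smul, ← pow_succ', ← add_smul]
    congr 1
    push_cast
    ring

lemma exists_eta_eq [FiniteDimensional ℂ V] (hv : IsHighestWeightVector m lam eta v) {a : Fin m}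
    (ha : ∀ j, j ≤ a) : ∃ k : ℕ,
      eta = (lam a - k) * (∑ j, lam j - (m + 1 : ℕ) + lam a - k) := by
  obtain ⟨k, hk⟩ := exists_ladder_coeff_eq_zero hv.ne_zero
    (Algebra.lsmul ℂ ℂ V (yW m a.castSucc)) (Algebra.lsmul ℂ ℂ V (lastW m a))
    (Algebra.lsmul ℂ ℂ V (eW m a a)) (w := fun k => lam a - k)
    (fun a b h => by simpa using h)
    (fun k => by simpa only [← map_pow, Algebra.lsmul_coe, if_true] using
      hv.eW_diag_smul_lastW_pow_smul a a k)
    (c := fun k => -(k + 1 : ℂ) *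
      (eta - (lam a - k) * (∑ j, lam j - (m + 1 : ℕ) + lam a - k)))
    (fun k => by simpa only [← map_pow, Algebra.lsmul_coe] using
      hv.yW_smul_lastW_pow_succ_smul ha k)
  exact ⟨k, sub_eq_zero.1 ((mul_eq_zero.1 hk).resolve_left
    (neg_ne_zero.2 (Nat.cast_add_one_ne_zero k)))⟩

end IsHighestWeightVector

end FiniteW

/-- Here `n = r + 2 ≥ 2`, the numbers `λ_1, …, λ_{n-1}` are `lam : Fin (r + 1) → ℂ`, and the
irreducible quotient `L(λ_1, …, λ_{n-1}, η_n)` of the Verma module is its quotient by a maximal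
proper submodule `N`. -/
theorem proposition3p5 (r : ℕ) (lam : Fin (r + 1) → ℂ) (eta : ℂ)
    (N : Submodule (FiniteW.sigmaTauW (r + 1)) (FiniteW.Verma (r + 1) lam eta))
    (hN : IsCoatom N)
    (hfin : FiniteDimensional ℂ (FiniteW.Verma (r + 1) lam eta ⧸ N)) :
    (∀ i : Fin r, ∃ d : ℕ, lam i.castSucc - lam i.succ = (d : ℂ)) ∧
    ∃ k : ℕ, 1 ≤ k ∧
      eta = (lam (Fin.last r) + 1 - (k : ℂ)) *
        (∑ i, lam i - ((r + 2 : ℕ) : ℂ) + lam (Fin.last r) + 1 - (k : ℂ)) := by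
  have hv := FiniteW.isHighestWeightVector_mk (r + 1) lam eta N hN.1
  refine ⟨fun i => hv.exists_sub_eq_natCast i.castSucc_lt_succ, ?_⟩
  -- The index `n-1` is the largest in `Fin (r + 1)`, as the second ladder requires.
  obtain ⟨k, hk⟩ := hv.exists_eta_eq Fin.le_last
  -- The ladder counts from `0`, the statement from `1`: `λ + 1 - (k + 1) = λ - k`.
  refine ⟨k + 1, by omega, hk.trans ?_⟩
  push_cast
  ring
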